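/- Let $L^2$ be the Lebesgue space on the unit circle $\mathbb{T}$ and let $H^2\subset L^2$ be the Hardy space, i.e. the functions whose Fourier coefficients of negative index vanish. Let $\mathbb{P}:L^2\to H^2$ be the Riesz projection, that is, the orthogonal projection of $L^2$ onto $H^2$. Let $\mathrm{Rat}(\mathbb{T})$ be the space of rational complex functions whose poles in $\mathbb{C}$ all lie on $\mathbb{T}$. Let $\mathrm{Rat}_0(\mathbb{T})$ be the subspace of strictly proper functions in $\mathrm{Rat}(\mathbb{T})$. For $\omega\in\mathrm{Rat}(\mathbb{T})$ let $T_\omega$ be the (in general unbounded) Toeplitz-like operator on $H^2$ given by $$\mathrm{Dom}(T_\omega)=\{g\in H^2 : \omega g=f+\rho \text{ for some } f\in L^2,\ \rho\in\mathrm{Rat}_0(\mathbb{T})\},\qquad T_\omega g=\mathbb{P}f .$$ Let $H(\overline{\mathbb{D}})$ be the space of functions analytic on a neighbourhood of the closed unit disc $\overline{\mathbb{D}}$, regarded as a subspace of $H^2$ through boundary values. **Theorem.** Let $\omega\in\mathrm{Rat}(\mathbb{T})$. Then $H(\overline{\mathbb{D}})\subset\mathrm{Dom}(T_\omega)$. If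 moreover $\omega$ is proper (that is, $\omega=s/q$ with coprime polynomials $s,q$ and $\deg s\le\deg q$), then $H(\overline{\mathbb{D}})$ is a core of $T_\omega$, that is, the graph of the restriction $T_\omega|_{H(\overline{\mathbb{D}})}$ is dense in the graph of $T_\omega$. -/

import Mathlib

open MeasureTheory AddCircle Filter Topology

namespace ToeplitzLike

/-! ### Rational functions -/

/-- Rational functions all of whose (finite) poles lie on the unit circle. The numerator and the
denominator of a `RatFunc` are coprime, so the poles are the roots of the denominator. -/
def PolesOnCircle (ω : RatFunc ℂ) : Prop :=
  ∀ z : ℂ, ω.denom.IsRoot z → ‖z‖ = 1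

/-- `ω = s / q` in lowest terms is proper if `deg s ≤ deg q`. -/
def IsProper (ω : RatFunc ℂ) : Prop :=
  ω.num.degree ≤ ω.denom.degree

/-- `ω = s / q` in lowest terms is strictly proper if `deg s < deg q`; this includes `ω = 0`. -/
def IsStrictlyProper (ω : RatFunc ℂ) : Prop :=
  ω.num.degree < ω.denom.degree

theorem IsStrictlyProper.add {ω ρ : RatFunc ℂ} (hω : IsStrictlyProper ω)
    (hρ : IsStrictlyProper ρ) : IsStrictlyProper (ω + ρ) := by
  unfold IsStrictlyProper at *
  have h := RatFunc.num_denom_add ω ρ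
  have h1 := ω.denom_ne_zero
  have h2 := ρ.denom_ne_zero
  have h3 := (ω + ρ).denom_ne_zero
  have hlt : (ω.num * ρ.denom + ω.denom * ρ.num).degree < (ω.denom * ρ.denom).degree := by
    refine lt_of_le_of_lt (Polynomial.degree_add_le _ _) (max_lt ?_ ?_)
    · rw [Polynomial.degree_mul, Polynomial.degree_mul]
      exact WithBot.add_lt_add_right (by simpa using h2) hω
    · rw [Polynomial.degree_mul, Polynomial.degree_mul]
      exact WithBot.add_lt_add_left (by simpa using h1) hρ
  by_contra! hc
  have h4 : (ω.num * ρ.denom + ω.denom * ρ.num).degree + (ω + ρ).denom.degree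
      < (ω.denom * ρ.denom).degree + (ω + ρ).num.degree :=
    lt_of_lt_of_le (WithBot.add_lt_add_right (by simpa using h3) hlt) (by gcongr)
  rw [← Polynomial.degree_mul, ← Polynomial.degree_mul, ← h, mul_comm] at h4
  exact lt_irrefl _ h4

theorem denom_C_mul_dvd (c : ℂ) (ρ : RatFunc ℂ) : (RatFunc.C c * ρ).denom ∣ ρ.denom := by
  simpa using RatFunc.denom_mul_dvd (RatFunc.C c) ρ

theorem IsStrictlyProper.C_mul (c : ℂ) {ρ : RatFunc ℂ} (hρ : IsStrictlyProper ρ) :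
    IsStrictlyProper (RatFunc.C c * ρ) := by
  unfold IsStrictlyProper at *
  have h := RatFunc.num_denom_mul (RatFunc.C c) ρ
  rw [RatFunc.num_C, RatFunc.denom_C, one_mul] at h
  have h3 := (RatFunc.C c * ρ).denom_ne_zero
  by_contra! hc
  have hlt : (Polynomial.C c * ρ.num).degree < ρ.denom.degree :=
    by
    refine lt_of_le_of_lt (Polynomial.degree_mul_le _ _) (lt_of_le_of_lt ?_ hρ)
    simpa using add_le_add_left (Polynomial.degree_C_le (a := c)) ρ.num.degree
  have h4 := lt_of_lt_of_le
    (WithBot.add_lt_add_right (z := (RatFunc.C c * ρ).denom.degree) (by simpa using h3) hlt)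
    (add_le_add_right hc ρ.denom.degree)
  rw [← Polynomial.degree_mul, ← Polynomial.degree_mul, ← h, mul_comm] at h4
  exact lt_irrefl _ h4

theorem PolesOnCircle.of_dvd {ω : RatFunc ℂ} {p : Polynomial ℂ}
    (h : ω.denom ∣ p) (hp : ∀ z : ℂ, p.IsRoot z → ‖z‖ = 1) : PolesOnCircle ω :=
  fun z hz => hp z (hz.dvd h)

theorem PolesOnCircle.add {ω ρ : RatFunc ℂ} (hω : PolesOnCircle ω) (hρ : PolesOnCircle ρ) :
    PolesOnCircle (ω + ρ) := by
  refine .of_dvd (RatFunc.denom_add_dvd ω ρ) fun z hz => ?_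
  rcases Polynomial.root_mul.1 hz with h | h
  exacts [hω z h, hρ z h]

/-! ### Lebesgue and Hardy space on the unit circle -/

/-- The point `exp (2 π i t)` of the unit circle. -/
noncomputable def circlePoint (t : UnitAddCircle) : ℂ := (toCircle t : ℂ)

/-- The space `L²` of the unit circle with normalised arc length. -/
abbrev L2 : Type := Lp ℂ 2 (haarAddCircle : Measure UnitAddCircle)

/-- The Hardy space `H²`, as the space of all `L²` functions on the circle whose Fourier
coefficients with negative index vanish. -/
noncomputable def H2 : Submodule ℂ L2 where
  carrier := {f | ∀ n : ℤ, n < 0 → fourierCoeff f n = 0}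
  zero_mem' n _ := by
    rw [← fourierBasis_repr]; simp
  add_mem' {f g} hf hg n hn := by
    have h1 := hf n hn
    have h2 := hg n hn
    rw [← fourierBasis_repr] at h1 h2 ⊢
    simp [h1, h2]
  smul_mem' c f hf n hn := by
    have h1 := hf n hn
    rw [← fourierBasis_repr] at h1 ⊢
    simp [h1]

theorem isClosed_H2 : IsClosed (H2 : Set L2) := by
  have : (H2 : Set L2) = ⋂ n : ℤ, ⋂ _ : n < 0,
      {f : L2 | inner ℂ (fourierBasis n : L2) f = 0} := by
    ext f
    simp only [Set.mem_iInter, Set.mem_ofPred_eq, ← HilbertBasis.repr_apply_apply, fourierBasis_repr]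
    rfl
  rw [this]
  refine isClosed_iInter fun n => isClosed_iInter fun _ => isClosed_eq ?_ continuous_const
  exact (innerSL ℂ _).continuous

instance : CompleteSpace H2 := isClosed_H2.completeSpace_coe

/-- The Riesz projection of `L²` onto `H²`; in the Hilbert space case it is the orthogonal
projection. -/
noncomputable def rieszProjection : L2 →L[ℂ] H2 := H2.orthogonalProjectionOnto

/-! ### Toeplitz-like operators -/

/-- The values of a rational function on the unit circle (with value `0` at the finitely many
poles). -/
noncomputable def boundaryValue (ω : RatFunc ℂ) (t : UnitAddCircle) : ℂ :=
  ω.eval (RingHom.id ℂ) (circlePoint t)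

theorem ae_eval_ne_zero {p : Polynomial ℂ} (hp : p ≠ 0) :
    ∀ᵐ t ∂(haarAddCircle : Measure UnitAddCircle), p.eval (circlePoint t) ≠ 0 := by
  have hfin : {t : UnitAddCircle | p.eval (circlePoint t) = 0}.Finite := by
    have : {t : UnitAddCircle | p.eval (circlePoint t) = 0} ⊆ circlePoint ⁻¹' {z | p.IsRoot z} :=
      fun t ht => ht
    refine ((Polynomial.finite_setOfPred_isRoot hp).preimage ?_).subset this
    intro a _ b _ hab
    exact injective_toCircle one_ne_zero (Subtype.ext hab)
  rw [ae_iff]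
  have : NullSingletonClass (haarAddCircle : Measure UnitAddCircle) := ⟨fun x => by
    have h := AddCircle.volume_closedBall (1 : ℝ) (x := x) 0
    rw [volume_eq_smul_haarAddCircle] at h
    simpa using h⟩
  simpa using hfin.measure_zero (haarAddCircle : Measure UnitAddCircle)

theorem ae_boundaryValue_add (ω ρ : RatFunc ℂ) :
    ∀ᵐ t ∂(haarAddCircle : Measure UnitAddCircle),
      boundaryValue (ω + ρ) t = boundaryValue ω t + boundaryValue ρ t := by
  filter_upwards [ae_eval_ne_zero ω.denom_ne_zero, ae_eval_ne_zero ρ.denom_ne_zero] with t h1 h2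
  exact RatFunc.eval_add _ _ (by simpa using h1) (by simpa using h2)

theorem ae_boundaryValue_C_mul (c : ℂ) (ρ : RatFunc ℂ) :
    ∀ᵐ t ∂(haarAddCircle : Measure UnitAddCircle),
      boundaryValue (RatFunc.C c * ρ) t = c * boundaryValue ρ t := by
  filter_upwards [ae_eval_ne_zero ρ.denom_ne_zero] with t h1
  have := RatFunc.eval_mul (RingHom.id ℂ) (circlePoint t) (x := RatFunc.C c) (y := ρ)
    (by simp) (by simpa using h1)
  simpa [boundaryValue] using this

/-- The graph of the Toeplitz-like operator with symbol `ω`: all pairs `(g, P f)` with `g ∈ H²`,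
`f ∈ L²` and `ω g = f + ρ` almost everywhere on the circle for some strictly proper rational
function `ρ` with poles only on the circle. -/
noncomputable def toeplitzGraph (ω : RatFunc ℂ) : Submodule ℂ (H2 × H2) where
  carrier := {p | ∃ (f : L2) (ρ : RatFunc ℂ), IsStrictlyProper ρ ∧ PolesOnCircle ρ ∧
    (∀ᵐ t ∂(haarAddCircle : Measure UnitAddCircle),
      boundaryValue ω t * (p.1 : L2) t = f t + boundaryValue ρ t) ∧
    p.2 = rieszProjection f}
  zero_mem' := by
    refine ⟨0, 0, by simp [IsStrictlyProper], by simp [PolesOnCircle, Polynomial.IsRoot], ?_,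
      by simp⟩
    filter_upwards [Lp.coeFn_zero ℂ 2 (haarAddCircle : Measure UnitAddCircle)] with t _
    simp [boundaryValue]
  add_mem' := by
    rintro ⟨g₁, h₁⟩ ⟨g₂, h₂⟩ ⟨f₁, ρ₁, hs₁, hp₁, he₁, rfl⟩ ⟨f₂, ρ₂, hs₂, hp₂, he₂, rfl⟩
    refine ⟨f₁ + f₂, ρ₁ + ρ₂, hs₁.add hs₂, hp₁.add hp₂, ?_, by simp⟩
    filter_upwards [he₁, he₂, Lp.coeFn_add f₁ f₂, Lp.coeFn_add (g₁ : L2) (g₂ : L2),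
      ae_boundaryValue_add ρ₁ ρ₂] with t a1 a2 a3 a4 a5
    simp only [Prod.mk_add_mk, Submodule.coe_add, a3, a4, a5, Pi.add_apply, mul_add] at a1 a2 ⊢
    rw [a1, a2]; ring
  smul_mem' := by
    rintro c ⟨g, h⟩ ⟨f, ρ, hs, hp, he, rfl⟩
    refine ⟨c • f, RatFunc.C c * ρ, hs.C_mul c, .of_dvd (denom_C_mul_dvd c ρ) hp, ?_, by simp⟩
    filter_upwards [he, Lp.coeFn_smul c f, Lp.coeFn_smul c (g : L2),
      ae_boundaryValue_C_mul c ρ] with t a1 a2 a3 a4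
    simp only [Prod.smul_mk, Submodule.coe_smul, a2, a3, a4, Pi.smul_apply, smul_eq_mul] at a1 ⊢
    rw [mul_left_comm, a1, mul_add]

theorem hasDerivAt_circlePoint (x : ℝ) :
    HasDerivAt (fun y : ℝ => circlePoint (y : UnitAddCircle))
      (2 * Real.pi * Complex.I * circlePoint (x : UnitAddCircle)) x := by
  have := hasDerivAt_fourier (1 : ℝ) 1 x
  simpa [circlePoint] using this

theorem circlePoint_surj {z : ℂ} (hz : ‖z‖ = 1) : ∃ x : ℝ, circlePoint (x : UnitAddCircle) = z := by
  refine ⟨z.arg / (2 * Real.pi), ?_⟩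
  have : 2 * Real.pi / 1 * (z.arg / (2 * Real.pi)) = z.arg := by field_simp
  rw [circlePoint, toCircle_apply_mk, this, Circle.coe_exp]
  simpa [hz] using Complex.norm_mul_exp_arg_mul_I z

/-- A strictly proper rational function with poles on the circle that is square integrable on the
circle is zero. -/
theorem eq_zero_of_boundaryValue_ae_eq {ρ : RatFunc ℂ} (hs : IsStrictlyProper ρ)
    (hp : PolesOnCircle ρ) (f : L2)
    (h : ∀ᵐ t ∂(haarAddCircle : Measure UnitAddCircle), boundaryValue ρ t = f t) : ρ = 0 := by
  by_cases hdeg : ρ.denom.degree = 0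
  · rw [IsStrictlyProper, hdeg] at hs
    rw [← RatFunc.num_eq_zero_iff]
    by_contra hne
    exact absurd hs (not_lt.2 (Polynomial.zero_le_degree_iff.2 hne))
  exfalso
  obtain ⟨z, hz⟩ := Complex.exists_root (Polynomial.degree_pos_of_ne_zero_of_nonunit ρ.denom_ne_zero
    (fun hu => hdeg (Polynomial.degree_eq_zero_of_isUnit hu)))
  obtain ⟨x, hx⟩ := circlePoint_surj (hp z hz)
  obtain ⟨b, hb⟩ := Polynomial.dvd_iff_isRoot.2 hz
  have hnum : ρ.num.eval z ≠ 0 := by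
    intro h0
    obtain ⟨u, v, huv⟩ := RatFunc.isCoprime_num_denom ρ
    have := congrArg (Polynomial.eval z) huv
    simp [h0, show ρ.denom.eval z = 0 from hz] at this
  -- integrability of the boundary values
  have hint : Integrable (boundaryValue ρ) (volume : Measure UnitAddCircle) := by
    have hf : Integrable f (haarAddCircle : Measure UnitAddCircle) :=
      (Lp.memLp f).integrable (by norm_num)
    have := hf.congr (h.mono fun t ht => ht.symm)
    rw [volume_eq_smul_haarAddCircle]
    exact this.smul_measure (by simp)
  have hii : IntervalIntegrable (fun y : ℝ => boundaryValue ρ (y : UnitAddCircle)) volume x (x + 1) := by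
    rw [intervalIntegrable_iff_integrableOn_Ioc_of_le (by linarith)]
    exact (UnitAddCircle.measurePreserving_mk x).integrable_comp_of_integrable hint
  refine not_intervalIntegrable_of_sub_inv_isBigO_punctured (c := x) ?_ (by linarith)
    (Set.left_mem_uIcc) hii
  have hd := hasDerivAt_circlePoint x
  have hcont : ContinuousAt (fun y : ℝ => circlePoint (y : UnitAddCircle)) x := hd.continuousAt
  have hO1 : (fun y : ℝ => circlePoint (y : UnitAddCircle) - z) =O[𝓝[≠] x] fun y => y - x := by
    have := hd.differentiableAt.isBigO_sub
    rw [hx] at this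
    exact this.mono nhdsWithin_le_nhds
  have hne : ∀ᶠ y : ℝ in 𝓝[≠] x, circlePoint (y : UnitAddCircle) ≠ z := by
    have := hd.eventually_ne (c := z) (by rw [hx]; simp [← norm_ne_zero_iff, hp z hz, Real.pi_ne_zero])
    exact this
  have hO2 : (fun y : ℝ => (y - x)⁻¹) =O[𝓝[≠] x]
      fun y : ℝ => (circlePoint (y : UnitAddCircle) - z)⁻¹ := by
    refine hO1.inv_rev ?_
    filter_upwards [hne] with y hy h0
    exact absurd h0 (sub_ne_zero.2 hy)
  refine hO2.trans ?_
  have hcq : ContinuousAt (fun y : ℝ => b.eval (circlePoint (y : UnitAddCircle)) /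
      ρ.num.eval (circlePoint (y : UnitAddCircle))) x := by
    refine ContinuousAt.div (b.continuous.continuousAt.comp hcont)
      (ρ.num.continuous.continuousAt.comp hcont) (by rwa [hx])
  have hO3 : (fun y : ℝ => b.eval (circlePoint (y : UnitAddCircle)) /
      ρ.num.eval (circlePoint (y : UnitAddCircle)) * boundaryValue ρ (y : UnitAddCircle)) =O[𝓝[≠] x]
      fun y : ℝ => (1 : ℂ) * boundaryValue ρ (y : UnitAddCircle) :=
    ((hcq.tendsto.mono_left nhdsWithin_le_nhds).isBigO_one ℂ).mul
      (Asymptotics.isBigO_refl _ _)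
  simp only [one_mul] at hO3
  refine hO3.congr' ?_ EventuallyEq.rfl |>.trans (Asymptotics.isBigO_refl _ _)
  have hnum' : ∀ᶠ y : ℝ in 𝓝[≠] x, ρ.num.eval (circlePoint (y : UnitAddCircle)) ≠ 0 :=
    ((ρ.num.continuous.continuousAt.comp hcont).eventually_ne
      (by simpa [hx] using hnum)).filter_mono nhdsWithin_le_nhds
  have hb' : ∀ᶠ y : ℝ in 𝓝[≠] x, b.eval (circlePoint (y : UnitAddCircle)) ≠ 0 := by
    have hb0 : b ≠ 0 := fun h0 => ρ.denom_ne_zero (by rw [hb, h0, mul_zero])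
    have hfin : ({w | b.IsRoot w} \ {z}).Finite := (Polynomial.finite_setOfPred_isRoot hb0).sdiff
    have hmem : ({w | b.IsRoot w} \ {z})ᶜ ∈ 𝓝 (circlePoint (x : UnitAddCircle)) :=
      hfin.isClosed.isOpen_compl.mem_nhds (by simp [hx])
    filter_upwards [hne, nhdsWithin_le_nhds (hcont hmem)] with y h1 h2 h3
    exact h2 ⟨h3, h1⟩
  filter_upwards [hnum', hb', hne] with y h1 h2 h3
  have h4 := sub_ne_zero.2 h3
  simp only [boundaryValue, RatFunc.eval, Polynomial.eval₂_id]
  rw [hb]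
  simp only [Polynomial.eval_mul, Polynomial.eval_sub, Polynomial.eval_X, Polynomial.eval_C]
  field_simp

/-- The graph relation is single valued: `f` and `ρ` are determined by `g`. -/
theorem toeplitzGraph_snd_eq_zero (ω : RatFunc ℂ) (p : H2 × H2) (hp : p ∈ toeplitzGraph ω)
    (h0 : p.1 = 0) : p.2 = 0 := by
  obtain ⟨f, ρ, hs, hpo, he, h2⟩ := hp
  have hρ : ρ = 0 := by
    refine eq_zero_of_boundaryValue_ae_eq hs hpo (-f) ?_
    filter_upwards [he, Lp.coeFn_neg f, Lp.coeFn_zero ℂ 2 (haarAddCircle : Measure UnitAddCircle)]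
      with t a1 a2 a3
    rw [h0, ZeroMemClass.coe_zero, a3] at a1
    rw [a2, Pi.neg_apply, eq_neg_iff_add_eq_zero, add_comm, ← a1]
    simp
  have hf : f = 0 := by
    rw [Lp.eq_zero_iff_ae_eq_zero]
    filter_upwards [he, Lp.coeFn_zero ℂ 2 (haarAddCircle : Measure UnitAddCircle)] with t a1 a3
    rw [h0, ZeroMemClass.coe_zero, a3, hρ] at a1
    simpa [boundaryValue] using a1.symm
  rw [h2, hf, map_zero]

/-- The Toeplitz-like operator `T_ω` on `H²`, a partially defined linear operator: its domain
consists of all `g ∈ H²` with `ω g = f + ρ` on the circle, where `f ∈ L²` and `ρ` is strictly proper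
with poles only on the circle, and `T_ω g = P f`. -/
noncomputable def toeplitz (ω : RatFunc ℂ) : H2 →ₗ.[ℂ] H2 :=
  (toeplitzGraph ω).toLinearPMap

theorem toeplitz_graph (ω : RatFunc ℂ) : (toeplitz ω).graph = toeplitzGraph ω :=
  Submodule.toLinearPMap_graph_eq _ (toeplitzGraph_snd_eq_zero ω)

theorem mem_toeplitz_domain_iff (ω : RatFunc ℂ) (g : H2) :
    g ∈ (toeplitz ω).domain ↔ ∃ (f : L2) (ρ : RatFunc ℂ), IsStrictlyProper ρ ∧ PolesOnCircle ρ ∧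
      ∀ᵐ t ∂(haarAddCircle : Measure UnitAddCircle),
        boundaryValue ω t * (g : L2) t = f t + boundaryValue ρ t := by
  constructor
  · rintro ⟨⟨_, h⟩, ⟨f, ρ, h1, h2, h3, _⟩, rfl⟩
    exact ⟨f, ρ, h1, h2, h3⟩
  · rintro ⟨f, ρ, h1, h2, h3⟩
    exact ⟨(g, rieszProjection f), ⟨f, ρ, h1, h2, h3, rfl⟩, rfl⟩

/-! ### Functions analytic near the closed disc, and cores -/

/-- The space of (boundary values of) functions analytic on a neighbourhood of the closed unit
disc, as a subspace of `H²`. -/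
noncomputable def analyticClosedDisc : Submodule ℂ H2 where
  carrier := {g | ∃ F : ℂ → ℂ, AnalyticOnNhd ℂ F (Metric.closedBall 0 1) ∧
    ∀ᵐ t ∂(haarAddCircle : Measure UnitAddCircle), (g : L2) t = F (circlePoint t)}
  zero_mem' := by
    refine ⟨0, fun z _ => analyticAt_const, ?_⟩
    filter_upwards [Lp.coeFn_zero ℂ 2 (haarAddCircle : Measure UnitAddCircle)] with t ht
    simp
  add_mem' := by
    rintro g₁ g₂ ⟨F₁, hF₁, h₁⟩ ⟨F₂, hF₂, h₂⟩
    refine ⟨F₁ + F₂, hF₁.add hF₂, ?_⟩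
    filter_upwards [h₁, h₂, Lp.coeFn_add (g₁ : L2) (g₂ : L2)] with t a1 a2 a3
    rw [Submodule.coe_add, a3, Pi.add_apply, a1, a2, Pi.add_apply]
  smul_mem' := by
    rintro c g ⟨F, hF, h⟩
    refine ⟨c • F, hF.const_smul, ?_⟩
    filter_upwards [h, Lp.coeFn_smul c (g : L2)] with t a1 a2
    rw [Submodule.coe_smul, a2, Pi.smul_apply, a1, Pi.smul_apply]

/-- Every function analytic on a neighbourhood of the closed disc has its boundary values in
`H²`. -/
theorem exists_mem_analyticClosedDisc {F : ℂ → ℂ}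
    (hF : AnalyticOnNhd ℂ F (Metric.closedBall 0 1)) :
    ∃ g ∈ analyticClosedDisc, ∀ᵐ t ∂(haarAddCircle : Measure UnitAddCircle),
      ((g : H2) : L2) t = F (circlePoint t) := by
  have hmem : ∀ t : UnitAddCircle, circlePoint t ∈ Metric.closedBall (0 : ℂ) 1 := fun t => by
    rw [mem_closedBall_zero_iff]; exact (Circle.norm_coe _).le
  have hcp : Continuous circlePoint := continuous_subtype_val.comp continuous_toCircle
  let φ : C(UnitAddCircle, ℂ) := ⟨fun t => F (circlePoint t),
    hF.continuousOn.comp_continuous hcp hmem⟩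
  let f : L2 := ContinuousMap.toLp (E := ℂ) 2 haarAddCircle ℂ φ
  have hf : ∀ᵐ t ∂(haarAddCircle : Measure UnitAddCircle), f t = F (circlePoint t) :=
    ContinuousMap.coeFn_toLp haarAddCircle φ
  have hfH : f ∈ H2 := by
    intro n hn
    obtain ⟨k, hk⟩ : ∃ k : ℕ, -n = k + 1 := ⟨(-n - 1).toNat, by omega⟩
    rw [fourierCoeff_toLp, fourierCoeff_eq_intervalIntegral _ _ 0]
    have hC : ∮ z in C(0, 1), z ^ k * F z = 0 := by
      refine Complex.circleIntegral_eq_zero_of_differentiable_on_off_countable zero_le_one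
        Set.countable_empty ?_ ?_
      · exact (continuous_pow k).continuousOn.mul hF.continuousOn
      · intro z hz
        exact (differentiableAt_pow k).mul
          (hF z (Metric.ball_subset_closedBall hz.1)).differentiableAt
    have hsub := intervalIntegral.integral_comp_mul_left (a := 0) (b := 1)
      (fun θ : ℝ => deriv (circleMap 0 1) θ • (circleMap 0 1 θ ^ k * F (circleMap 0 1 θ)))
      (c := 2 * Real.pi) (by positivity)
    rw [mul_zero, mul_one] at hsub
    rw [circleIntegral] at hC
    rw [hC, smul_zero] at hsub
    have hpt : ∀ x : ℝ, deriv (circleMap 0 1) (2 * Real.pi * x) •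
        (circleMap 0 1 (2 * Real.pi * x) ^ k * F (circleMap 0 1 (2 * Real.pi * x))) =
        Complex.I * (fourier (-n) (x : UnitAddCircle) • φ (x : UnitAddCircle)) := by
      intro x
      have hw : circleMap 0 1 (2 * Real.pi * x) = circlePoint (x : UnitAddCircle) := by
        simp [circleMap, circlePoint, toCircle_apply_mk, Circle.coe_exp]
      have hfo : fourier (-n) (x : UnitAddCircle) = circlePoint (x : UnitAddCircle) ^ (k + 1) := by
        rw [hk, fourier_apply, toCircle_zsmul, circlePoint]
        norm_cast
      rw [deriv_circleMap, hw, hfo]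
      simp only [φ, ContinuousMap.coe_mk, smul_eq_mul]
      ring
    simp only [hpt] at hsub
    rw [intervalIntegral.integral_const_mul] at hsub
    have := (mul_eq_zero.1 hsub).resolve_left Complex.I_ne_zero
    rw [zero_add, this, smul_zero]
  exact ⟨⟨f, hfH⟩, ⟨F, hF, hf⟩, hf⟩

/-- A subspace `D` of the domain of `T` is a core of `T` if the graph of the restriction of `T` to
`D` is dense in the graph of `T`. -/
structure IsCore {H : Type*} [NormedAddCommGroup H] [InnerProductSpace ℂ H]
    (T : H →ₗ.[ℂ] H) (D : Submodule ℂ H) : Prop where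
  le_domain : D ≤ T.domain
  graph_subset_closure :
    (T.graph : Set (H × H)) ⊆ closure ((T.domRestrict D).graph : Set (H × H))

end ToeplitzLike

/-!
Write `ω = s / q` in lowest terms. For every `k ∈ H²` the pair `(q k, s k)` lies in the graph of
`T_ω`, and it depends continuously on `k`. Conversely, every `g` in the domain is `q k + r` with
`k ∈ H²` and `r` a polynomial: if `u s + v q = 1` and `ω g = f + ρ`, then `k = u f + v g` satisfies
`g - q k = q u ρ`. The right-hand side is a rational function with poles on the circle that is
square integrable there, hence a polynomial; so `q k ∈ H²`, and this forces `k ∈ H²` because the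
roots of `q` lie on the circle. As functions analytic near the closed disc are dense in `H²` and
stable under multiplication by `q`, approximating `k` by such functions approximates `(g, T_ω g)`
within the graph of the restriction. Polynomials `r` are in the domain because `ω r` is the sum of a
polynomial and a strictly proper function. If `g` is analytic near the closed disc, division with
remainder by `q` gives `g = q k + r` with `k` analytic, whence `g` is in the domain.
-/

namespace ToeplitzLike

open Polynomial

section Polynomial

theorem induction_on_linear_factors {K : Type*} [Field K] [IsAlgClosed K] {P : K[X] → Prop}
    {q : K[X]} (hq : q ≠ 0) (const : ∀ c ≠ 0, P (C c)) (mul : ∀ p r, P p → P r → P (p * r))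
    (linear : ∀ a, q.IsRoot a → P (X - C a)) : P q := by
  rw [(IsAlgClosed.splits q).eq_prod_roots]
  refine mul _ _ (const _ (leadingCoeff_ne_zero.2 hq)) ?_
  refine Multiset.prod_induction P _ mul (by simpa using const 1 one_ne_zero) fun p hp => ?_
  obtain ⟨a, ha, rfl⟩ := Multiset.mem_map.1 hp
  exact linear a (isRoot_of_mem_roots ha)

end Polynomial

section RatFunc

theorem isStrictlyProper_div {n d : ℂ[X]} (h : n.degree < d.degree) :
    IsStrictlyProper (algebraMap _ (RatFunc ℂ) n / algebraMap _ (RatFunc ℂ) d) := by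
  set ρ := algebraMap _ (RatFunc ℂ) n / algebraMap _ (RatFunc ℂ) d
  have cross : ρ.num * d = n * ρ.denom :=
    (RatFunc.num_mul_eq_mul_denom_iff (ne_zero_of_degree_gt h)).2 rfl
  have degrees := congrArg degree cross
  rw [degree_mul, degree_mul] at degrees
  by_contra! hle
  refine degrees.not_gt ?_
  calc n.degree + ρ.denom.degree < d.degree + ρ.denom.degree :=
        WithBot.add_lt_add_right (degree_ne_bot.2 ρ.denom_ne_zero) h
    _ ≤ d.degree + ρ.num.degree := by gcongr; exact not_lt.1 hle
    _ = ρ.num.degree + d.degree := add_comm _ _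

theorem exists_eq_algebraMap_add_isStrictlyProper (ω : RatFunc ℂ) :
    ∃ (p : ℂ[X]) (σ : RatFunc ℂ), IsStrictlyProper σ ∧ σ.denom ∣ ω.denom ∧
      ω = algebraMap _ _ p + σ := by
  refine ⟨ω.num / ω.denom, _, isStrictlyProper_div (degree_mod_lt ω.num ω.denom_ne_zero),
    RatFunc.denom_div_dvd _ _, ?_⟩
  have hdenom : algebraMap _ (RatFunc ℂ) ω.denom ≠ 0 :=
    RatFunc.algebraMap_ne_zero ω.denom_ne_zero
  conv_lhs => rw [← RatFunc.num_div_denom ω, ← EuclideanDomain.div_add_mod ω.num ω.denom]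
  rw [map_add, map_mul]
  field_simp

theorem PolesOnCircle.algebraMap_mul (p : ℂ[X]) {ω : RatFunc ℂ} (hω : PolesOnCircle ω) :
    PolesOnCircle (algebraMap _ _ p * ω) :=
  .of_dvd (by simpa using RatFunc.denom_mul_dvd (algebraMap _ _ p) ω) hω

theorem boundaryValue_eq_div (ω : RatFunc ℂ) (t : UnitAddCircle) :
    boundaryValue ω t = ω.num.eval (circlePoint t) / ω.denom.eval (circlePoint t) := by
  simp [boundaryValue, RatFunc.eval, eval₂_id]

theorem boundaryValue_algebraMap (p : ℂ[X]) (t : UnitAddCircle) :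
    boundaryValue (algebraMap _ _ p) t = p.eval (circlePoint t) := by
  simp [boundaryValue_eq_div]

theorem ae_boundaryValue_algebraMap_mul (p : ℂ[X]) (ω : RatFunc ℂ) :
    ∀ᵐ t ∂haarAddCircle,
      boundaryValue (algebraMap _ _ p * ω) t = p.eval (circlePoint t) * boundaryValue ω t := by
  filter_upwards [ae_eval_ne_zero ω.denom_ne_zero] with t ht
  rw [← boundaryValue_algebraMap]
  exact RatFunc.eval_mul _ _ (by simp) (by simpa using ht)

theorem ae_boundaryValue_algebraMap_add (p : ℂ[X]) (ω : RatFunc ℂ) :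
    ∀ᵐ t ∂haarAddCircle,
      boundaryValue (algebraMap _ _ p + ω) t = p.eval (circlePoint t) + boundaryValue ω t := by
  simpa only [boundaryValue_algebraMap] using ae_boundaryValue_add (algebraMap _ _ p) ω

theorem ae_boundaryValue_mul_eval_denom (ω : RatFunc ℂ) :
    ∀ᵐ t ∂haarAddCircle,
      boundaryValue ω t * ω.denom.eval (circlePoint t) = ω.num.eval (circlePoint t) := by
  filter_upwards [ae_eval_ne_zero ω.denom_ne_zero] with t ht
  rw [boundaryValue_eq_div, div_mul_cancel₀ _ ht]

end RatFunc

section Shift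

/-- The bilateral shift: multiplication by the coordinate function `z = fourier 1` on `L²`. -/
noncomputable def bilateralShift : L2 →L[ℂ] L2 :=
  (ContinuousLinearMap.mul ℂ ℂ).holderL haarAddCircle ⊤ 2 2 (fourierLp ⊤ 1)

theorem coeFn_bilateralShift (f : L2) :
    bilateralShift f =ᵐ[haarAddCircle] fun t => circlePoint t * f t := by
  filter_upwards [(ContinuousLinearMap.mul ℂ ℂ).coeFn_holder (r := 2) (fourierLp ⊤ 1) f,
    coeFn_fourierLp (T := 1) ⊤ 1] with t hprod hz
  rw [bilateralShift, ContinuousLinearMap.holderL_apply_apply, hprod, hz, fourier_one,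
    ContinuousLinearMap.mul_apply', circlePoint]

theorem fourierCoeff_bilateralShift (f : L2) (n : ℤ) :
    fourierCoeff (bilateralShift f) n = fourierCoeff f (n - 1) := by
  refine integral_congr_ae ?_
  filter_upwards [coeFn_bilateralShift f] with t ht
  have hmonomial : fourier (-(n - 1)) t = fourier (-n) t * circlePoint t := by
    rw [neg_sub', sub_neg_eq_add, fourier_add, fourier_one, circlePoint]
  rw [ht, hmonomial, smul_eq_mul, smul_eq_mul, mul_assoc]

theorem bilateralShift_mem_H2 {f : L2} (hf : f ∈ H2) : bilateralShift f ∈ H2 := fun n hn => by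
  rw [fourierCoeff_bilateralShift]
  exact hf _ (by omega)

/-- The unilateral shift: the restriction of the bilateral shift to `H²`. -/
noncomputable def unilateralShift : H2 →L[ℂ] H2 :=
  bilateralShift.restrict fun _ => bilateralShift_mem_H2

/-- Multiplication by polynomials on `L²`, as the polynomial calculus of the bilateral shift. -/
noncomputable def mulL2 : ℂ[X] →ₐ[ℂ] L2 →L[ℂ] L2 := aeval bilateralShift

/-- Multiplication by polynomials on `H²`, as the polynomial calculus of the unilateral shift. -/
noncomputable def mulH2 : ℂ[X] →ₐ[ℂ] H2 →L[ℂ] H2 := aeval unilateralShift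

theorem mulL2_X : mulL2 X = bilateralShift := aeval_X _

theorem mulL2_C (c : ℂ) (f : L2) : mulL2 (C c) f = c • f := by
  rw [mulL2, aeval_C]; rfl

theorem mulH2_C (c : ℂ) (g : H2) : mulH2 (C c) g = c • g := by
  rw [mulH2, aeval_C]; rfl

theorem coe_mulH2 (p : ℂ[X]) (g : H2) : (mulH2 p g : L2) = mulL2 p g := by
  induction p using Polynomial.induction_on generalizing g with
  | C c => rw [mulH2_C, mulL2_C, Submodule.coe_smul]
  | add p q hp hq => simp only [map_add, add_apply, Submodule.coe_add, hp, hq]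
  | monomial n c ih =>
    have coe_shift : (mulH2 X g : L2) = mulL2 X g := by rw [mulH2, mulL2, aeval_X, aeval_X]; rfl
    rw [pow_succ, ← mul_assoc, map_mul _ (C c * X ^ n), map_mul _ (C c * X ^ n),
      mul_apply_eq_comp, mul_apply_eq_comp, ih, coe_shift]

theorem coeFn_mulL2 (p : ℂ[X]) (f : L2) :
    mulL2 p f =ᵐ[haarAddCircle] fun t => p.eval (circlePoint t) * f t := by
  induction p using Polynomial.induction_on generalizing f with
  | C c =>
    rw [mulL2_C]
    filter_upwards [Lp.coeFn_smul c f] with t ht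
    rw [ht, Pi.smul_apply, eval_C, smul_eq_mul]
  | add p q hp hq =>
    rw [map_add, add_apply]
    filter_upwards [hp f, hq f, Lp.coeFn_add (mulL2 p f) (mulL2 q f)] with t hpt hqt hadd
    rw [hadd, Pi.add_apply, hpt, hqt, eval_add, add_mul]
  | monomial n c ih =>
    rw [pow_succ, ← mul_assoc, map_mul, mul_apply_eq_comp]
    filter_upwards [ih (mulL2 X f), mulL2_X ▸ coeFn_bilateralShift f] with t hmonomial hshift
    rw [hmonomial, hshift, eval_mul_X, mul_assoc]

theorem coeFn_mulH2 (p : ℂ[X]) (g : H2) :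
    (mulH2 p g : L2) =ᵐ[haarAddCircle] fun t => p.eval (circlePoint t) * (g : L2) t := by
  rw [coe_mulH2]
  exact coeFn_mulL2 p g

/-- The constant function `1` in `H²`. -/
noncomputable def oneH2 : H2 :=
  ⟨fourierLp 2 0, fun n hn => by
    rw [fourierCoeff_congr_ae (coeFn_fourierLp 2 0), fourierCoeff_fourier,
      Pi.single_eq_of_ne hn.ne]⟩

theorem coeFn_oneH2 : (oneH2 : L2) =ᵐ[haarAddCircle] 1 := by
  filter_upwards [coeFn_fourierLp (T := 1) 2 0] with t ht
  exact ht.trans fourier_zero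

/-- The boundary values of a polynomial, as an element of `H²`. -/
noncomputable def polyH2 (p : ℂ[X]) : H2 := mulH2 p oneH2

theorem coeFn_polyH2 (p : ℂ[X]) :
    (polyH2 p : L2) =ᵐ[haarAddCircle] fun t => p.eval (circlePoint t) := by
  filter_upwards [coeFn_mulH2 p oneH2, coeFn_oneH2] with t hmul hone
  rw [polyH2, hmul, hone, Pi.one_apply, mul_one]

theorem polyH2_X_pow (n : ℕ) : (polyH2 (X ^ n) : L2) = fourierLp 2 n := by
  refine Lp.ext ?_
  filter_upwards [coeFn_polyH2 (X ^ n), coeFn_fourierLp (T := 1) 2 n] with t hpoly hfourier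
  rw [hpoly, hfourier, eval_pow, eval_X, fourier_apply, circlePoint, natCast_zsmul,
    toCircle_nsmul, Circle.coe_pow]

theorem tendsto_fourierCoeff_cofinite_zero (f : L2) :
    Tendsto (fourierCoeff f) cofinite (𝓝 0) := by
  have summable_sq : Summable fun n => ‖fourierCoeff f n‖ ^ 2 := by
    simpa [fourierBasis_repr] using (lp.memℓp (fourierBasis.repr f)).summable (by norm_num)
  rw [tendsto_zero_iff_norm_tendsto_zero]
  simpa [Real.sqrt_sq] using summable_sq.tendsto_cofinite_zero.sqrt

theorem mem_H2_of_mulL2_X_sub_C_mem {a : ℂ} (ha : ‖a‖ = 1) {f : L2}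
    (h : mulL2 (X - C a) f ∈ H2) : f ∈ H2 := by
  -- Along the negative indices the coefficients have constant modulus, yet tend to `0`.
  have recursion : ∀ n < 0, fourierCoeff f (n - 1) = a * fourierCoeff f n := by
    intro n hn
    have hcoeff := h n hn
    rw [map_sub, sub_apply, mulL2_C, mulL2_X, ← fourierBasis_repr, map_sub,
      map_smul, lp.coeFn_sub, lp.coeFn_smul, Pi.sub_apply, Pi.smul_apply, fourierBasis_repr,
      fourierBasis_repr, fourierCoeff_bilateralShift, smul_eq_mul] at hcoeff
    exact sub_eq_zero.1 hcoeff
  intro n hn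
  have norm_const : ∀ m : ℕ, ‖fourierCoeff f (n - m)‖ = ‖fourierCoeff f n‖ := by
    intro m
    induction m with
    | zero => simp
    | succ m ih =>
      rw [← ih, Nat.cast_succ, ← sub_sub, recursion _ (by omega), norm_mul, ha, one_mul]
  have decay : Tendsto (fun m : ℕ => ‖fourierCoeff f (n - m)‖) atTop (𝓝 0) := by
    have injective : Function.Injective fun m : ℕ => n - m := fun i j hij => by simpa using hij
    rw [← Nat.cofinite_eq_atTop]
    exact ((tendsto_fourierCoeff_cofinite_zero f).comp injective.tendsto_cofinite).norm.trans
      (by rw [norm_zero])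
  simp only [norm_const] at decay
  exact norm_eq_zero.1 (tendsto_nhds_unique tendsto_const_nhds decay)

theorem mem_H2_of_mulL2_mem {q : ℂ[X]} (hq : q ≠ 0) (hroots : ∀ z, q.IsRoot z → ‖z‖ = 1)
    {f : L2} (h : mulL2 q f ∈ H2) : f ∈ H2 := by
  refine induction_on_linear_factors (P := fun q => ∀ f : L2, mulL2 q f ∈ H2 → f ∈ H2) hq
    (fun c hc f hf => ?_) (fun p r hp hr f hf => ?_)
    (fun a ha _ => mem_H2_of_mulL2_X_sub_C_mem (hroots a ha)) f h
  · rw [mulL2_C] at hf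
    exact (H2.smul_mem_iff hc).1 hf
  · rw [map_mul] at hf
    exact hr f (hp _ hf)

end Shift

section Analytic

theorem analyticAt_dslope {𝕜 E : Type*} [NontriviallyNormedField 𝕜] [NormedAddCommGroup E]
    [NormedSpace 𝕜 E] {F : 𝕜 → E} {z : 𝕜} (hF : AnalyticAt 𝕜 F z) (a : 𝕜) :
    AnalyticAt 𝕜 (dslope F a) z := by
  rcases eq_or_ne z a with rfl | hne
  · obtain ⟨p, hp⟩ := hF
    exact ⟨_, hp.has_fpower_series_dslope_fslope⟩
  · refine AnalyticAt.congr ?_ (dslope_eventuallyEq_slope_of_ne F hne).symm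
    exact ((analyticAt_id.sub analyticAt_const).inv (sub_ne_zero.2 hne)).smul
      (hF.sub analyticAt_const)

theorem mulH2_mem_analyticClosedDisc (p : ℂ[X]) {g : H2} (hg : g ∈ analyticClosedDisc) :
    mulH2 p g ∈ analyticClosedDisc := by
  obtain ⟨F, hF, hgF⟩ := hg
  refine ⟨fun z => p.eval z * F z,
    ((AnalyticOnNhd.eval_polynomial p).mono (Set.subset_univ _)).mul hF, ?_⟩
  filter_upwards [hgF, coeFn_mulH2 p g] with t hgt hmul
  rw [hmul, hgt]

theorem polyH2_mem_analyticClosedDisc (p : ℂ[X]) : polyH2 p ∈ analyticClosedDisc :=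
  mulH2_mem_analyticClosedDisc p ⟨1, fun _ _ => analyticAt_const, coeFn_oneH2⟩

theorem dense_analyticClosedDisc : Dense (analyticClosedDisc : Set H2) := by
  rw [Submodule.dense_iff_topologicalClosure_eq_top, Submodule.topologicalClosure_eq_top_iff,
    Submodule.eq_bot_iff]
  intro g hg
  have hcoeff : ∀ n : ℤ, fourierBasis.repr (g : L2) n = 0 := by
    intro n
    rcases lt_or_ge n 0 with hn | hn
    · rw [fourierBasis_repr]
      exact g.2 n hn
    · lift n to ℕ using hn
      rw [HilbertBasis.repr_apply_apply, coe_fourierBasis, ← polyH2_X_pow]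
      exact hg _ (polyH2_mem_analyticClosedDisc _)
  exact Subtype.ext ((map_eq_zero_iff _ fourierBasis.repr.injective).1 (lp.ext (funext hcoeff)))

theorem exists_eq_mulH2_X_sub_C_add_polyH2 (a : ℂ) {g : H2} (hg : g ∈ analyticClosedDisc) :
    ∃ h ∈ analyticClosedDisc, ∃ r, g = mulH2 (X - C a) h + polyH2 r := by
  obtain ⟨F, hF, hgF⟩ := hg
  obtain ⟨h, hmem, hh⟩ := exists_mem_analyticClosedDisc fun z hz => analyticAt_dslope (hF z hz) a
  refine ⟨h, hmem, C (F a), Subtype.ext (Lp.ext ?_)⟩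
  filter_upwards [hgF, hh, coeFn_mulH2 (X - C a) h, coeFn_polyH2 (C (F a)),
    Lp.coeFn_add (mulH2 (X - C a) h : L2) (polyH2 (C (F a)))] with t hgt hht hmul hpoly hadd
  rw [Submodule.coe_add, hadd, Pi.add_apply, hmul, hpoly, hgt, hht, eval_sub, eval_X, eval_C,
    eval_C, ← smul_eq_mul, sub_smul_dslope, sub_add_cancel]

theorem exists_eq_mulH2_add_polyH2_of_mem_analyticClosedDisc {q : ℂ[X]} (hq : q ≠ 0) {g : H2}
    (hg : g ∈ analyticClosedDisc) :
    ∃ h ∈ analyticClosedDisc, ∃ r, g = mulH2 q h + polyH2 r := by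
  refine induction_on_linear_factors
    (P := fun q => ∀ g ∈ analyticClosedDisc, ∃ h ∈ analyticClosedDisc, ∃ r,
      g = mulH2 q h + polyH2 r)
    hq (fun c hc g hg => ?_) (fun p s hp hs g hg => ?_)
    (fun a _ g hg => exists_eq_mulH2_X_sub_C_add_polyH2 a hg) g hg
  · refine ⟨c⁻¹ • g, analyticClosedDisc.smul_mem _ hg, 0, ?_⟩
    rw [mulH2_C, smul_inv_smul₀ hc, polyH2, map_zero, zero_apply, add_zero]
  · obtain ⟨h₁, hh₁, r₁, rfl⟩ := hp g hg
    obtain ⟨h₂, hh₂, r₂, rfl⟩ := hs h₁ hh₁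
    refine ⟨h₂, hh₂, p * r₂ + r₁, ?_⟩
    simp only [polyH2, map_add, map_mul, add_apply,
      mul_apply_eq_comp, add_assoc]

end Analytic

section Domain

variable {ω : RatFunc ℂ}

theorem exists_eq_algebraMap_of_boundaryValue_ae_eq (hω : PolesOnCircle ω) (f : L2)
    (h : ∀ᵐ t ∂haarAddCircle, boundaryValue ω t = f t) : ∃ p : ℂ[X], ω = algebraMap _ _ p := by
  obtain ⟨p, σ, hproper, hdvd, rfl⟩ := exists_eq_algebraMap_add_isStrictlyProper ω
  have hσ : ∀ᵐ t ∂haarAddCircle, boundaryValue σ t = (f - polyH2 p : L2) t := by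
    filter_upwards [h, ae_boundaryValue_algebraMap_add p σ, coeFn_polyH2 p,
      Lp.coeFn_sub f (polyH2 p)] with t hf hadd hpoly hsub
    rw [hsub, Pi.sub_apply, hpoly, ← hf, hadd, add_sub_cancel_left]
  exact ⟨p, by rw [eq_zero_of_boundaryValue_ae_eq hproper (.of_dvd hdvd hω) _ hσ, add_zero]⟩

theorem polyH2_mem_domain_toeplitz (hω : PolesOnCircle ω) (r : ℂ[X]) :
    polyH2 r ∈ (toeplitz ω).domain := by
  obtain ⟨p, σ, hproper, hdvd, hσ⟩ :=
    exists_eq_algebraMap_add_isStrictlyProper (algebraMap _ _ r * ω)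
  refine (mem_toeplitz_domain_iff _ _).2
    ⟨polyH2 p, σ, hproper, .of_dvd hdvd (hω.algebraMap_mul r), ?_⟩
  filter_upwards [ae_boundaryValue_algebraMap_mul r ω, ae_boundaryValue_algebraMap_add p σ,
    coeFn_polyH2 r, coeFn_polyH2 p] with t hmul hadd hr hp
  rw [hr, hp, ← hadd, ← hσ, hmul, mul_comm]

theorem mulH2_denom_mulH2_num_mem_graph (ω : RatFunc ℂ) (k : H2) :
    (mulH2 ω.denom k, mulH2 ω.num k) ∈ (toeplitz ω).graph := by
  rw [toeplitz_graph]
  refine ⟨mulH2 ω.num k, 0, by simp [IsStrictlyProper], by simp [PolesOnCircle], ?_,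
    (Submodule.orthogonalProjectionOnto_mem_subspace_eq_self _).symm⟩
  filter_upwards [coeFn_mulH2 ω.denom k, coeFn_mulH2 ω.num k,
    ae_boundaryValue_mul_eval_denom ω] with t hdenom hnum hω
  rw [hdenom, hnum, ← mul_assoc, hω, boundaryValue, RatFunc.eval_zero, add_zero]

theorem analyticClosedDisc_le_domain_toeplitz (hω : PolesOnCircle ω) :
    analyticClosedDisc ≤ (toeplitz ω).domain := by
  intro g hg
  obtain ⟨h, -, r, rfl⟩ :=
    exists_eq_mulH2_add_polyH2_of_mem_analyticClosedDisc ω.denom_ne_zero hg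
  exact add_mem (LinearPMap.mem_domain_of_mem_graph (mulH2_denom_mulH2_num_mem_graph ω h))
    (polyH2_mem_domain_toeplitz hω r)

theorem exists_eq_mulH2_denom_add_polyH2_of_mem_domain (hω : PolesOnCircle ω) {g : H2}
    (hg : g ∈ (toeplitz ω).domain) : ∃ k r, g = mulH2 ω.denom k + polyH2 r := by
  obtain ⟨f, ρ, -, hρ, hgf⟩ := (mem_toeplitz_domain_iff ω g).1 hg
  obtain ⟨u, v, bezout⟩ := RatFunc.isCoprime_num_denom ω
  set k : L2 := mulL2 u f + mulL2 v g
  have remainder : ∀ᵐ t ∂haarAddCircle,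
      boundaryValue (algebraMap _ _ (ω.denom * u) * ρ) t = (g - mulL2 ω.denom k : L2) t := by
    filter_upwards [hgf, ae_boundaryValue_algebraMap_mul (ω.denom * u) ρ,
      ae_boundaryValue_mul_eval_denom ω, Lp.coeFn_sub (g : L2) (mulL2 ω.denom k),
      coeFn_mulL2 ω.denom k, Lp.coeFn_add (mulL2 u f) (mulL2 v g), coeFn_mulL2 u f,
      coeFn_mulL2 v g] with t hf hmul hω hsub hk hadd hu hv
    have hbezout := congrArg (eval (circlePoint t)) bezout
    rw [eval_add, eval_mul, eval_mul, eval_one] at hbezout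
    rw [hmul, eval_mul, hsub, Pi.sub_apply, hk, hadd, Pi.add_apply, hu, hv]
    linear_combination (-ω.denom.eval (circlePoint t) * u.eval (circlePoint t)) * hf +
      u.eval (circlePoint t) * (g : L2) t * hω + (g : L2) t * hbezout
  obtain ⟨r, hr⟩ :=
    exists_eq_algebraMap_of_boundaryValue_ae_eq (hρ.algebraMap_mul _) _ remainder
  have hgk : (g : L2) - mulL2 ω.denom k = polyH2 r := by
    refine Lp.ext ?_
    filter_upwards [remainder, coeFn_polyH2 r] with t hremainder hpoly
    rw [hpoly, ← hremainder, hr, boundaryValue_algebraMap]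
  have hkH2 : k ∈ H2 := by
    refine mem_H2_of_mulL2_mem ω.denom_ne_zero hω ?_
    rw [← sub_sub_cancel (g : L2) (mulL2 ω.denom k), hgk]
    exact H2.sub_mem g.2 (polyH2 r).2
  refine ⟨⟨k, hkH2⟩, r, Subtype.ext ?_⟩
  rw [Submodule.coe_add, coe_mulH2, ← hgk, add_sub_cancel]

end Domain

section Core

theorem mem_graph_domRestrict {R E F : Type*} [Ring R] [AddCommGroup E] [Module R E]
    [AddCommGroup F] [Module R F] {T : E →ₗ.[R] F} {D : Submodule R E} {p : E × F}
    (hp : p ∈ T.graph) (hD : p.1 ∈ D) : p ∈ (T.domRestrict D).graph := by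
  obtain ⟨y, hy, hTy⟩ := (LinearPMap.mem_graph_iff T).1 hp
  exact (LinearPMap.mem_graph_iff _).2
    ⟨⟨p.1, hD, hy ▸ y.2⟩, rfl, (LinearPMap.domRestrict_apply hy.symm).trans hTy⟩

theorem isCore_of_dense {H K : Type*} [NormedAddCommGroup H] [InnerProductSpace ℂ H]
    [TopologicalSpace K] {T : H →ₗ.[ℂ] H} {D : Submodule ℂ H} (hD : D ≤ T.domain)
    {A : K → H × H} (hA : Continuous A) (hAT : ∀ k, A k ∈ T.graph) {S : Set K} (hS : Dense S)
    (hSD : ∀ k ∈ S, (A k).1 ∈ D) (decomp : ∀ g ∈ T.domain, ∃ k, g - (A k).1 ∈ D) :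
    IsCore T D where
  le_domain := hD
  graph_subset_closure := by
    intro p hp
    obtain ⟨k, hk⟩ := decomp p.1 (LinearPMap.mem_domain_of_mem_graph hp)
    have hAk : A k ∈ (T.domRestrict D).graph.topologicalClosure :=
      map_mem_closure hA (hS k) fun x hx => mem_graph_domRestrict (hAT x) (hSD x hx)
    have hdiff : p - A k ∈ (T.domRestrict D).graph :=
      mem_graph_domRestrict (sub_mem hp (hAT k)) hk
    rw [← sub_add_cancel p (A k)]
    exact add_mem (Submodule.le_topologicalClosure _ hdiff) hAk

end Core

end ToeplitzLike

open ToeplitzLike in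
theorem theorem6p2_general (ω : RatFunc ℂ) (hω : PolesOnCircle ω) :
    IsCore (toeplitz ω) analyticClosedDisc := by
  refine isCore_of_dense (analyticClosedDisc_le_domain_toeplitz hω)
    (A := fun k => (mulH2 ω.denom k, mulH2 ω.num k)) (by fun_prop)
    (mulH2_denom_mulH2_num_mem_graph ω) dense_analyticClosedDisc
    (fun k => mulH2_mem_analyticClosedDisc ω.denom) fun g hg => ?_
  obtain ⟨k, r, rfl⟩ := exists_eq_mulH2_denom_add_polyH2_of_mem_domain hω hg
  exact ⟨k, by simpa using polyH2_mem_analyticClosedDisc r⟩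

theorem theorem6p2 (ω : RatFunc ℂ) (hω : ToeplitzLike.PolesOnCircle ω) :
    ToeplitzLike.analyticClosedDisc ≤ (ToeplitzLike.toeplitz ω).domain ∧
    (ToeplitzLike.IsProper ω →
      ToeplitzLike.IsCore (ToeplitzLike.toeplitz ω) ToeplitzLike.analyticClosedDisc) :=
  ⟨(theorem6p2_general ω hω).le_domain, fun _ => theorem6p2_general ω hω⟩
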